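/- A broadcast protocol (BP) consists of a finite set $S$ of states with an initial state $s_0$, a finite set $A$ of actions, for every action $a\in A$ exactly one sending transition $s_a \xrightarrow{a!!} s_a'$, and for every action $a$ and every state $s$ exactly one response $s \xrightarrow{a??} r_a(s)$. Its size $|B|$ is its number of states. A configuration is a vector $\mathbf q\in\mathbb N^{S}$, counting the processes in each state. There is a transition $\mathbf q\xrightarrow{a}\mathbf q'$ iff $\mathbf q(s_a)\ge 1$ and $\mathbf q' = \mathbf M_a(\mathbf q-\mathbf u_{s_a})+\mathbf u_{s_a'}$, where $\mathbf u_s$ is the unit vector of $s$ and $\mathbf M_a$ is the $0/1$ matrix with $\mathbf M_a(m,k)=1$ iff $r_a(k)=m$. $L(B^n)\subseteq A^*$ is the set of words that label a sequence of transitions starting from the configuration $n\cdot\mathbf u_{s_0}$, and $L(B)=\bigcup_{n\in\mathbb N}L(B^n)$. $B$ is fine if every state is the origin $s_a$ of the sending transition of some action $a$, and $B$ has a cutoff, i.e. there is $k$ with $L(B^{k})=L(B^{k'})$ for all $k'>k$. Corollary. There exists a family of fine BPs for which the corresponding minimal DFA is of exponential size. That is, there are a constant $c>1$ and a sequence $(B_n)_{n\in\mathbb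 N}$ of fine BPs with $|B_n|\to\infty$ such that, for every $n$, $L(B_n)$ is accepted by a minimal DFA (a complete DFA with finitely many states such that no finite complete DFA for $L(B_n)$ has fewer states), and this DFA has at least $c^{|B_n|}$ states. -/

import Mathlib

open Filter

/-- A broadcast protocol with finite sets of states and actions. For every action `a` there is a
unique sending transition `(source a, a!!, target a)`, and from every state `s` there is exactly
one response `(s, a??, response a s)`. -/
structure BroadcastProtocol where
  State : Type
  Action : Type
  [fintypeState : Fintype State]
  [decEqState : DecidableEq State]
  [fintypeAction : Fintype Action]
  init : State
  source : Action → State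
  target : Action → State
  response : Action → State → State

namespace BroadcastProtocol

attribute [instance] fintypeState decEqState fintypeAction

variable (B : BroadcastProtocol)

/-- The size of a broadcast protocol is its number of states. -/
def size : ℕ := Fintype.card B.State

/-- A configuration assigns to every state the number of processes in it. -/
abbrev Config : Type := B.State → ℕ

/-- The initial configuration of the system of `n` processes: all of them in the initial state. -/
def initConfig (n : ℕ) : B.Config := Pi.single B.init n

/-- The broadcast matrix of `a`: entry `(m, k)` is `1` iff the response to `a` leads from `k`
to `m`. -/
def broadcastMatrix (a : B.Action) : Matrix B.State B.State ℕ :=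
  Matrix.of fun m k => if B.response a k = m then 1 else 0

/-- The global transition `(q, a, q')`: some process in the state `source a` broadcasts `a` and
moves to `target a`, and all the other processes respond. The subtraction is exact because of the
first conjunct. -/
def Step (q : B.Config) (a : B.Action) (q' : B.Config) : Prop :=
  1 ≤ q (B.source a) ∧
    q' = (B.broadcastMatrix a).mulVec (q - Pi.single (B.source a) 1) + Pi.single (B.target a) 1

/-- `B.Exec q w q'`: there is a sequence of global transitions from `q` to `q'` based on the
word `w`. -/
inductive Exec : B.Config → List B.Action → B.Config → Prop
  | nil (q : B.Config) : Exec q [] q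
  | cons {q q' q'' : B.Config} {a : B.Action} {w : List B.Action} :
      B.Step q a q' → Exec q' w q'' → Exec q (a :: w) q''

/-- The language of the system of `n` processes: all words that are feasible in it. -/
def systemLanguage (n : ℕ) : Language B.Action :=
  {w | ∃ q : B.Config, B.Exec (B.initConfig n) w q}

/-- The language of a broadcast protocol: the union of the languages of all its systems. -/
def language : Language B.Action :=
  {w | ∃ n : ℕ, w ∈ B.systemLanguage n}

/-- `k` is a cutoff. -/
def HasCutoff (k : ℕ) : Prop :=
  ∀ k' : ℕ, k < k' → B.systemLanguage k = B.systemLanguage k'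

/-- Every state has an outgoing sending transition. -/
def NoHiddenStates : Prop :=
  ∀ s : B.State, ∃ a : B.Action, B.source a = s

/-- A broadcast protocol is fine if it has no hidden states and has a cutoff. -/
def IsFine : Prop :=
  B.NoHiddenStates ∧ ∃ k : ℕ, B.HasCutoff k

end BroadcastProtocol

/-- A finite automaton is minimal if no finite automaton for the same language has fewer states. -/
def IsMinimalDFA {α Q : Type} [Fintype Q] (M : DFA α Q) : Prop :=
  ∀ (Q' : Type) [Fintype Q'] (M' : DFA α Q'),
    M'.accepts = M.accepts → Fintype.card Q ≤ Fintype.card Q'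

/-!
The protocol `flagProtocol m` has a pool state, in which all processes start, and `m` flag states.
The action "set `i`" moves one process from the pool to flag `i`, and any process that was at flag
`i` responds by returning to the pool; the action "reset `i`" moves a process from flag `i` back to
the pool. Hence every flag always holds at most one process, and a reachable configuration is
determined by the number of processes and the set `T` of raised flags (`flagConfig`). With more than
`m` processes the pool is never empty, so setting is always possible, and resetting `i` is possible
iff `i ∈ T`. Thus every number of processes greater than `m` gives the same language
(`systemLanguage_flagProtocol`), which is recognised by the automaton `flagDFA m` that stores `T`,
with one additional rejecting sink (`none`). All its `2 ^ m + 1` states are reachable, and "reset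
`i`" separates two sets that differ in `i`, so the automaton is minimal, while the protocol has
only `m + 1` states.
-/

open BroadcastProtocol

/-! ### Minimality of automata -/

/-- A finite automaton is minimal if all its states are reachable and distinct states are
distinguished by some word. -/
theorem isMinimalDFA_of_reachable_of_distinguishable {α Q : Type} [Fintype Q] (M : DFA α Q)
    (reach : ∀ x, ∃ w, M.eval w = x)
    (dist : ∀ x y, (∀ w, M.evalFrom x w ∈ M.accept ↔ M.evalFrom y w ∈ M.accept) → x = y) :
    IsMinimalDFA M := by
  intro Q' _ M' h
  choose word hword using reach
  refine Fintype.card_le_of_injective (fun x => M'.eval (word x)) fun x y hxy => dist x y fun w => ?_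
  have key (z : Q) :
      M.evalFrom z w ∈ M.accept ↔ M'.evalFrom (M'.eval (word z)) w ∈ M'.accept := by
    have hz : word z ++ w ∈ M'.accepts ↔ word z ++ w ∈ M.accepts := by rw [h]
    rw [DFA.mem_accepts, DFA.mem_accepts, DFA.eval, DFA.eval, DFA.evalFrom_of_append,
      DFA.evalFrom_of_append] at hz
    rw [show M.evalFrom M.start (word z) = z from hword z] at hz
    exact hz.symm
  rw [key x, key y]
  exact iff_of_eq (congrArg (fun q => M'.evalFrom q w ∈ M'.accept) hxy)

/-! ### The protocol -/

/-- The protocol with pool state `none` and flag states `some i` for `i : Fin m`. The action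
`Sum.inl i` sets flag `i`: a process moves from the pool to the flag, and those already at the flag
respond by going back to the pool. The action `Sum.inr i` resets flag `i`: a process moves from the
flag to the pool, and all the others stay where they are. -/
abbrev flagProtocol (m : ℕ) : BroadcastProtocol where
  State := Option (Fin m)
  Action := Fin m ⊕ Fin m
  init := none
  source := Sum.elim (fun _ => none) some
  target := Sum.elim some (fun _ => none)
  response := Sum.elim (fun i s => if s = some i then none else s) (fun _ s => s)

/-- The configuration of `N` processes in which each flag of `T` holds one process and all the
remaining processes are in the pool. It is meaningful only for `T.card ≤ N`, where the subtraction
is exact. -/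
def flagConfig {m : ℕ} (N : ℕ) (T : Finset (Fin m)) : (flagProtocol m).Config
  | none => N - T.card
  | some i => if i ∈ T then 1 else 0

theorem flagProtocol_size (m : ℕ) : (flagProtocol m).size = m + 1 := by
  change Fintype.card (Option (Fin m)) = m + 1
  simp

theorem noHiddenStates_flagProtocol (m : ℕ) [NeZero m] : (flagProtocol m).NoHiddenStates
  | none => ⟨Sum.inl (0 : Fin m), rfl⟩
  | some i => ⟨Sum.inr i, rfl⟩

theorem initConfig_flagProtocol (m N : ℕ) :
    (flagProtocol m).initConfig N = flagConfig N ∅ := by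
  funext s
  cases s with
  | none => exact (Pi.single_eq_same _ _).trans (by simp [flagConfig])
  | some i => exact (Pi.single_eq_of_ne (Option.some_ne_none i) _).trans (by simp [flagConfig])

theorem broadcastMatrix_mulVec_set {m : ℕ} (i : Fin m) (v : Option (Fin m) → ℕ) :
    ((flagProtocol m).broadcastMatrix (Sum.inl i)).mulVec v =
      fun s => s.elim (v none + v (some i)) fun k => if k = i then 0 else v (some k) := by
  funext s
  change ∑ k : Option (Fin m), (if (if k = some i then none else k) = s then 1 else 0) * v k = _
  rw [Fintype.sum_option]
  cases s with
  | none => simp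
  | some k =>
    have (j : Fin m) : ((if some j = some i then none else some j) = some k) ↔ j = k ∧ k ≠ i := by
      split_ifs <;> grind
    simp only [this]
    by_cases hk : k = i <;> simp [hk]

theorem broadcastMatrix_reset {m : ℕ} (i : Fin m) :
    (flagProtocol m).broadcastMatrix (Sum.inr i) = 1 := by
  ext s t
  change (if t = s then 1 else 0) = _
  rw [Matrix.one_apply]
  exact if_congr eq_comm rfl rfl

/-- If flag `i` was already raised, the process there and a process of the pool swap places. -/
theorem step_set_iff {m N : ℕ} {T : Finset (Fin m)} (i : Fin m) (q : (flagProtocol m).Config) :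
    (flagProtocol m).Step (flagConfig N T) (Sum.inl i) q ↔
      T.card < N ∧ q = flagConfig N (insert i T) := by
  have hcard := Finset.card_insert_eq_ite (s := T) (a := i)
  change 1 ≤ N - T.card ∧ q = _ ↔ _
  rw [show 1 ≤ N - T.card ↔ T.card < N by omega, and_congr_right_iff]
  intro hlt
  rw [broadcastMatrix_mulVec_set]
  refine iff_of_eq (congrArg (q = ·) (funext fun s => ?_))
  cases s with
  | none =>
    change N - T.card - (Pi.single none 1 : Option (Fin m) → ℕ) none +
      ((if i ∈ T then 1 else 0) - (Pi.single none 1 : Option (Fin m) → ℕ) (some i)) +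
      (Pi.single (some i) 1 : Option (Fin m) → ℕ) none = N - (insert i T).card
    simp only [Pi.single_apply, reduceCtorEq, if_true, if_false]
    split_ifs at hcard ⊢ <;> grind
  | some k =>
    change (if k = i then 0 else
      (if k ∈ T then 1 else 0) - (Pi.single none 1 : Option (Fin m) → ℕ) (some k)) +
      (Pi.single (some i) 1 : Option (Fin m) → ℕ) (some k) = if k ∈ insert i T then 1 else 0
    simp only [Pi.single_apply, reduceCtorEq, if_false, Option.some.injEq, Finset.mem_insert]
    split_ifs <;> grind

theorem step_reset_iff {m N : ℕ} {T : Finset (Fin m)} (hT : T.card ≤ N) (i : Fin m)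
    (q : (flagProtocol m).Config) :
    (flagProtocol m).Step (flagConfig N T) (Sum.inr i) q ↔
      i ∈ T ∧ q = flagConfig N (T.erase i) := by
  change 1 ≤ (if i ∈ T then 1 else 0) ∧ q = _ ↔ _
  rw [show 1 ≤ (if i ∈ T then 1 else 0) ↔ i ∈ T by split_ifs with h <;> simp [h],
    and_congr_right_iff]
  intro hi
  rw [broadcastMatrix_reset, Matrix.one_mulVec]
  have hcard := Finset.card_erase_of_mem hi
  have hpos : 0 < T.card := Finset.card_pos.2 ⟨i, hi⟩
  refine iff_of_eq (congrArg (q = ·) (funext fun s => ?_))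
  cases s with
  | none =>
    change N - T.card - (Pi.single (some i) 1 : Option (Fin m) → ℕ) none +
      (Pi.single none 1 : Option (Fin m) → ℕ) none = N - (T.erase i).card
    simp only [Pi.single_apply, reduceCtorEq, if_true, if_false]
    omega
  | some k =>
    change (if k ∈ T then 1 else 0) - (Pi.single (some i) 1 : Option (Fin m) → ℕ) (some k) +
      (Pi.single none 1 : Option (Fin m) → ℕ) (some k) = if k ∈ T.erase i then 1 else 0
    simp only [Pi.single_apply, reduceCtorEq, if_false, Option.some.injEq, Finset.mem_erase]
    split_ifs <;> grind

/-! ### The automaton -/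

/-- The automaton that stores the set of raised flags. The state `none` is a rejecting sink,
entered when a flag is reset that is not raised. -/
def flagDFA (m : ℕ) : DFA (Fin m ⊕ Fin m) (Option (Finset (Fin m))) where
  step
    | none, _ => none
    | some T, Sum.inl i => some (insert i T)
    | some T, Sum.inr i => if i ∈ T then some (T.erase i) else none
  start := some ∅
  accept := {x | x.isSome}

theorem flagDFA_evalFrom_none {m : ℕ} (w : List (Fin m ⊕ Fin m)) :
    (flagDFA m).evalFrom none w = none := by
  induction w with
  | nil => rfl
  | cons a w ih => exact ih

theorem flagDFA_evalFrom_reset {m : ℕ} (T : Finset (Fin m)) (i : Fin m) :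
    (flagDFA m).evalFrom (some T) [Sum.inr i] ∈ (flagDFA m).accept ↔ i ∈ T := by
  change (if i ∈ T then some (T.erase i) else none).isSome = true ↔ _
  split_ifs with h <;> simp [h]

theorem flagDFA_evalFrom_set {m : ℕ} (l : List (Fin m)) (T : Finset (Fin m)) :
    (flagDFA m).evalFrom (some T) (l.map Sum.inl) = some (l.toFinset ∪ T) := by
  induction l generalizing T with
  | nil => simp
  | cons i l ih =>
    refine (ih (insert i T)).trans ?_
    simp

theorem isMinimalDFA_flagDFA (m : ℕ) [NeZero m] : IsMinimalDFA (flagDFA m) := by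
  refine isMinimalDFA_of_reachable_of_distinguishable _ ?_ ?_
  · rintro (_ | T)
    · exact ⟨[Sum.inr 0], rfl⟩
    · exact ⟨T.toList.map Sum.inl, (flagDFA_evalFrom_set _ _).trans (by simp)⟩
  · rintro (_ | S) (_ | T) h
    · rfl
    · exact absurd ((h []).2 rfl) Bool.false_ne_true
    · exact absurd ((h []).1 rfl) Bool.false_ne_true
    · congr 1
      ext i
      rw [← flagDFA_evalFrom_reset S, h, flagDFA_evalFrom_reset]

/-! ### The language of the protocol -/

theorem flagDFA_accepts_of_exec {m N : ℕ} {w : List (Fin m ⊕ Fin m)} {T : Finset (Fin m)}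
    (hT : T.card ≤ N) {q : (flagProtocol m).Config}
    (h : (flagProtocol m).Exec (flagConfig N T) w q) :
    (flagDFA m).evalFrom (some T) w ∈ (flagDFA m).accept := by
  induction w generalizing T with
  | nil => rfl
  | cons a w ih =>
    cases h with
    | cons hstep hexec =>
      rcases a with i | i
      · obtain ⟨hlt, rfl⟩ := (step_set_iff i _).1 hstep
        exact ih ((Finset.card_insert_le i T).trans hlt) hexec
      · obtain ⟨hi, rfl⟩ := (step_reset_iff hT i _).1 hstep
        have := ih ((Finset.card_erase_le).trans hT) hexec
        rwa [← if_pos (c := i ∈ T) (t := some (T.erase i)) (e := none) hi] at this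

theorem exists_exec_of_flagDFA_accepts {m N : ℕ} (hN : m < N) {w : List (Fin m ⊕ Fin m)}
    {T : Finset (Fin m)} (h : (flagDFA m).evalFrom (some T) w ∈ (flagDFA m).accept) :
    ∃ q, (flagProtocol m).Exec (flagConfig N T) w q := by
  induction w generalizing T with
  | nil => exact ⟨_, .nil _⟩
  | cons a w ih =>
    have hT : T.card < N := (card_finset_fin_le T).trans_lt hN
    rcases a with i | i
    · obtain ⟨q, hq⟩ := ih h
      exact ⟨q, .cons ((step_set_iff i _).2 ⟨hT, rfl⟩) hq⟩
    · change (flagDFA m).evalFrom (if i ∈ T then some (T.erase i) else none) w ∈ _ at h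
      by_cases hi : i ∈ T
      · rw [if_pos hi] at h
        obtain ⟨q, hq⟩ := ih h
        exact ⟨q, .cons ((step_reset_iff hT.le i _).2 ⟨hi, rfl⟩) hq⟩
      · rw [if_neg hi, flagDFA_evalFrom_none] at h
        exact absurd h Bool.false_ne_true

theorem systemLanguage_flagProtocol_le (m N : ℕ) :
    (flagProtocol m).systemLanguage N ≤ (flagDFA m).accepts := by
  rintro w ⟨q, hq⟩
  rw [initConfig_flagProtocol] at hq
  exact flagDFA_accepts_of_exec (Nat.zero_le N) hq

theorem systemLanguage_flagProtocol {m N : ℕ} (hN : m < N) :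
    (flagProtocol m).systemLanguage N = (flagDFA m).accepts := by
  refine le_antisymm (systemLanguage_flagProtocol_le m N) fun w hw => ?_
  obtain ⟨q, hq⟩ := exists_exec_of_flagDFA_accepts hN hw
  exact ⟨q, (initConfig_flagProtocol m N).symm ▸ hq⟩

theorem language_flagProtocol (m : ℕ) : (flagProtocol m).language = (flagDFA m).accepts :=
  le_antisymm (fun _ ⟨N, hw⟩ => systemLanguage_flagProtocol_le m N hw) fun _ hw =>
    ⟨m + 1, (systemLanguage_flagProtocol m.lt_succ_self).symm ▸ hw⟩

theorem isFine_flagProtocol (m : ℕ) [NeZero m] : (flagProtocol m).IsFine := by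
  refine ⟨noHiddenStates_flagProtocol m, m + 1, fun k hk => ?_⟩
  rw [systemLanguage_flagProtocol m.lt_succ_self, systemLanguage_flagProtocol (by omega)]

theorem mainTheorem4 :
    ∃ (c : ℝ) (B : ℕ → BroadcastProtocol),
      1 < c ∧
      (∀ n, (B n).IsFine) ∧
      Tendsto (fun n => (B n).size) atTop atTop ∧
      ∀ n, ∃ (Q : Type) (_ : Fintype Q) (M : DFA (B n).Action Q),
        M.accepts = (B n).language ∧
        IsMinimalDFA M ∧
        c ^ (B n).size ≤ (Fintype.card Q : ℝ) := by
  -- At least one flag is needed, for otherwise the pool would have no sending transition.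
  refine ⟨4 / 3, fun n => flagProtocol (n + 1), by norm_num, fun n => isFine_flagProtocol _, ?_,
    fun n => ⟨_, inferInstance, flagDFA (n + 1), (language_flagProtocol _).symm,
      isMinimalDFA_flagDFA _, ?_⟩⟩
  · simp only [flagProtocol_size]
    exact tendsto_atTop_mono (fun n => by dsimp only [id]; omega) tendsto_id
  · rw [flagProtocol_size, Fintype.card_option, Fintype.card_finset, Fintype.card_fin]
    push_cast
    -- The constant satisfies `(4 / 3) ^ 2 ≤ 2`, which is the required bound for `n = 0`.
    calc (4 / 3 : ℝ) ^ (n + 1 + 1) = (4 / 3) ^ n * (4 / 3) ^ 2 := by ring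
      _ ≤ 2 ^ n * 2 := by gcongr <;> norm_num
      _ ≤ 2 ^ (n + 1) + 1 := by rw [pow_succ]; linarith
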